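/- Let $N\ge 1$, let $\Omega\subset\mathbb{R}^N$ be an arbitrary bounded open set, let $0<s<1$ and let $p,q,r\in[2,\infty)$ satisfy $$p<q\qquad\text{and}\qquad r>\frac{N(q-p)}{sp}.$$ Let $W^{s,p}(\mathbb{R}^N)$ be the space of all $u\in L^p(\mathbb{R}^N)$ with $\int_{\mathbb{R}^N}\int_{\mathbb{R}^N}\frac{|u(x)-u(y)|^p}{|x-y|^{N+sp}}\,dx\,dy<\infty$, let $W_0^{s,p}(\Omega)=\{u\in W^{s,p}(\mathbb{R}^N): u=0 \text{ a.e. on }\mathbb{R}^N\setminus\Omega\}$, and let $V=W_0^{s,p}(\Omega)\cap L^r(\Omega)$. For $u\in V$ put $$\Phi(u)=\frac{C_{N,p,s}}{2p}\int_{\mathbb{R}^N}\int_{\mathbb{R}^N}\frac{|u(x)-u(y)|^p}{|x-y|^{N+sp}}\,dx\,dy,\qquad \psi(u)=\frac1q\int_\Omega|u|^q\,dx,\qquad \phi(u)=\frac1r\int_\Omega|u|^r\,dx,$$ where $$C_{N,p,s}=\frac{s\,2^{2s}\,\Gamma\!\left(\frac{ps+p+N-2}{2}\right)}{\pi^{N/2}\,\Gamma(1-s)}.$$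 Then there exist a constant $\varepsilon\in(0,1]$ and a (strictly) increasing differentiable function $\mathcal{F}:[0,\infty)\to[0,\infty)$ such that every $u\in V$ belongs to $L^q(\Omega)$ and satisfies $$\psi(u)\le \mathcal{F}(\phi(u))\,[\Phi(u)+1]^{1-\varepsilon}.$$ -/

import Mathlib

open MeasureTheory Set
open scoped ENNReal

noncomputable section

namespace FracPLap

/-- The space `ℝ^N` with its Euclidean norm (and Lebesgue measure `volume`). -/
abbrev E (N : ℕ) : Type := EuclideanSpace ℝ (Fin N)

/-- The normalization constant
`C_{N,p,s} = s 2^{2s} Γ((ps+p+N-2)/2) / (π^{N/2} Γ(1-s))`. -/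
def normConst (N : ℕ) (p s : ℝ) : ℝ :=
  s * (2 : ℝ) ^ (2 * s) * Real.Gamma ((p * s + p + (N : ℝ) - 2) / 2) /
    (Real.pi ^ ((N : ℝ) / 2) * Real.Gamma (1 - s))

/-- The double integral of `|u(x) - u(y)|^p / |x - y|^{N+sp}` over `ℝ^N × ℝ^N`,
as an element of `[0,∞]`. -/
def gagliardo (N : ℕ) (s p : ℝ) (u : E N → ℝ) : ℝ≥0∞ :=
  ∫⁻ x : E N, ∫⁻ y : E N,
    ENNReal.ofReal (|u x - u y| ^ p / ‖x - y‖ ^ ((N : ℝ) + s * p))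

/-- The fractional Sobolev space `W^{s,p}(ℝ^N)`. Its elements are represented by functions;
nothing below depends on the representative in the a.e. class. -/
def sobolev (N : ℕ) (s p : ℝ) : Set (E N → ℝ) :=
  {u | MemLp u (ENNReal.ofReal p) volume ∧ gagliardo N s p u < ∞}

/-- `W_0^{s,p}(Ω)`: the functions in `W^{s,p}(ℝ^N)` that vanish a.e. on `ℝ^N \ Ω`. -/
def sobolevZero (N : ℕ) (s p : ℝ) (Ω : Set (E N)) : Set (E N → ℝ) :=
  {u | u ∈ sobolev N s p ∧ ∀ᵐ x : E N, x ∉ Ω → u x = 0}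

/-- The energy space `V = W_0^{s,p}(Ω) ∩ L^r(Ω)`. -/
def energySpace (N : ℕ) (s p r : ℝ) (Ω : Set (E N)) : Set (E N → ℝ) :=
  {u | u ∈ sobolevZero N s p Ω ∧ MemLp u (ENNReal.ofReal r) (volume.restrict Ω)}

/-- The fractional `p`-energy
`Φ(u) = C_{N,p,s}/(2p) ∫∫ |u(x) - u(y)|^p / |x - y|^{N+sp} dx dy`, a real number; the double
integral is finite for every `u ∈ W^{s,p}(ℝ^N)`. -/
def pEnergy (N : ℕ) (s p : ℝ) (u : E N → ℝ) : ℝ :=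
  normConst N p s / (2 * p) * (gagliardo N s p u).toReal

/-- `(1/m) ∫_Ω |u|^m dx`, meant for `u ∈ L^m(Ω)`. The functional `ψ` is the case `m = q`,
the functional `φ` is the case `m = r`. -/
def powEnergy (N : ℕ) (m : ℝ) (Ω : Set (E N)) (u : E N → ℝ) : ℝ :=
  1 / m * ∫ x in Ω, |u x| ^ m

end FracPLap

end

namespace FracPLap

/-! With `S` bounding `∫ |u|^r` and `b = |u x| / 2`, the set where `|u| ≥ b` has measure at most `M
= S / b^r`. In a ball about `x` of volume `2 * M`, values differing from `u x` by at least `b`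
therefore fill measure at least `M`, which bounds the inner Gagliardo integral below by a multiple
of `|u x|^m / S^β`, where `β = s p / N` and `m = p + r β`. Integrating in `x`
(`lintegral_abs_rpow_le_gagliardo`) controls `∫ |u|^m` with no Sobolev embedding and no case split
on `s p` against `N`. Since `q < m` and `Ω` is bounded, Hölder (`integral_abs_rpow_le`) gives `ψ` at
most the power `q / m < 1` of that bound. -/

/-- Chebyshev's inequality on a ball of suitable radius bounds a power of `|u x|`
by the inner integral of the Gagliardo seminorm. -/
theorem ofReal_abs_rpow_le_lintegral {N : ℕ} (hN : 1 ≤ N) {s p r S : ℝ} (hs : 0 < s) (hp : 0 < p)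
    (hr : 0 < r) (hS : 0 < S) {u : E N → ℝ} (hu : AEMeasurable u volume)
    (huS : ∫⁻ y, ENNReal.ofReal (|u y| ^ r) ≤ ENNReal.ofReal S) (x : E N) :
    ENNReal.ofReal (|u x| ^ (p + r * (s * p / N))) ≤
      ENNReal.ofReal (2 ^ (p + r * (s * p / N)) *
          (2 / volume.real (Metric.ball (0 : E N) 1)) ^ (1 + s * p / N) * S ^ (s * p / N)) *
        ∫⁻ y : E N, ENNReal.ofReal (|u x - u y| ^ p / ‖x - y‖ ^ ((N : ℝ) + s * p)) := by
  have hN0 : (0 : ℝ) < N := by exact_mod_cast hN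
  have : Nonempty (Fin N) := ⟨⟨0, hN⟩⟩
  set β : ℝ := s * p / N with hβ
  have hβ0 : 0 < β := by positivity
  set ω : ℝ := volume.real (Metric.ball (0 : E N) 1) with hω
  have hω0 : 0 < ω := ENNReal.toReal_pos (Metric.measure_ball_pos _ _ one_pos).ne'
    measure_ball_lt_top.ne
  have hωe : volume (Metric.ball (0 : E N) 1) = ENNReal.ofReal ω :=
    (ENNReal.ofReal_toReal measure_ball_lt_top.ne).symm
  rcases (abs_nonneg (u x)).eq_or_lt with h0 | ha
  · rw [← h0, Real.zero_rpow (by positivity)]; simp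
  set b : ℝ := |u x| / 2 with hb
  have hb0 : 0 < b := by positivity
  set M : ℝ := S / b ^ r with hM
  have hM0 : 0 < M := by positivity
  -- This radius gives the ball volume `2 * M`, so removing a set of measure at most `M` leaves at
  -- least `M`.
  set h : ℝ := (2 * M / ω) ^ (1 / (N : ℝ)) with hh
  have hh0 : 0 < h := by positivity
  have hhN : h ^ (N : ℝ) = 2 * M / ω := by
    rw [hh, ← Real.rpow_mul (by positivity), one_div_mul_cancel hN0.ne', Real.rpow_one]
  have hhs : h ^ (s * p) = (2 * M / ω) ^ β := by
    rw [hh, ← Real.rpow_mul (by positivity), hβ]; congr 1; ring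
  have hball : volume (Metric.ball x h) = ENNReal.ofReal (2 * M) := by
    rw [Measure.addHaar_ball _ _ hh0.le, hωe, ← ENNReal.ofReal_mul (by positivity),
      finrank_euclideanSpace, Fintype.card_fin, ← Real.rpow_natCast, hhN,
      div_mul_cancel₀ _ hω0.ne']
  have hum : AEMeasurable (fun y => ENNReal.ofReal (|u y| ^ r)) volume :=
    ((hu.abs).pow_const r).ennreal_ofReal
  have hnull : NullMeasurableSet {y | b ≤ |u y|} volume :=
    nullMeasurableSet_le aemeasurable_const hu.abs
  have hcheb : volume {y | b ≤ |u y|} ≤ ENNReal.ofReal M := by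
    have h1 := mul_meas_ge_le_lintegral₀ hum (ENNReal.ofReal (b ^ r))
    have h2 : {y | b ≤ |u y|} ⊆ {y | ENNReal.ofReal (b ^ r) ≤ ENNReal.ofReal (|u y| ^ r)} :=
      fun y hy => ENNReal.ofReal_le_ofReal (Real.rpow_le_rpow hb0.le hy hr.le)
    rw [hM, ENNReal.ofReal_div_of_pos (by positivity), ENNReal.le_div_iff_mul_le
      (Or.inl (by simpa using Real.rpow_pos_of_pos hb0 r)) (Or.inl ENNReal.ofReal_ne_top), mul_comm]
    exact ((mul_le_mul_right (measure_mono h2) _).trans h1).trans huS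
  set T : Set (E N) := Metric.ball x h \ {y | b ≤ |u y|} with hT
  have hTn : NullMeasurableSet T volume := measurableSet_ball.nullMeasurableSet.diff hnull
  have hTm : ENNReal.ofReal M ≤ volume T := by
    calc ENNReal.ofReal M = ENNReal.ofReal (2 * M) - ENNReal.ofReal M := by
          rw [← ENNReal.ofReal_sub _ hM0.le]; congr 1; ring
      _ ≤ volume (Metric.ball x h) - volume {y | b ≤ |u y|} := by
          rw [hball]; exact tsub_le_tsub_left hcheb _
      _ ≤ volume T := le_measure_sdiff
  have hG : ENNReal.ofReal (b ^ p / h ^ ((N : ℝ) + s * p)) * ENNReal.ofReal M ≤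
      ∫⁻ y : E N, ENNReal.ofReal (|u x - u y| ^ p / ‖x - y‖ ^ ((N : ℝ) + s * p)) := by
    refine (mul_le_mul_right hTm _).trans ?_
    rw [← lintegral_indicator_const₀ hTn]
    refine lintegral_mono fun y => ?_
    by_cases hy : y ∈ T
    · rw [indicator_of_mem hy]
      have hyb : |u y| < b := not_le.1 hy.2
      have hyx : ‖x - y‖ < h := by
        have := hy.1
        rwa [Metric.mem_ball, dist_comm, dist_eq_norm] at this
      have hne : 0 < ‖x - y‖ := by
        rw [norm_pos_iff, sub_ne_zero]
        rintro rfl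
        linarith
      have hdiff : b ≤ |u x - u y| := by
        have := abs_sub_abs_le_abs_sub (u x) (u y)
        linarith
      apply ENNReal.ofReal_le_ofReal
      gcongr
    · rw [indicator_of_notMem hy]; exact zero_le
  -- The constant in the statement is exactly the one making this lower bound an equality.
  refine le_trans (le_of_eq ?_) (mul_le_mul_right hG _)
  rw [← ENNReal.ofReal_mul (by positivity), ← ENNReal.ofReal_mul (by positivity)]
  congr 1
  have hux : |u x| = 2 * b := by rw [hb]; ring
  have hMβ : (2 * M / ω) ^ β = (2 / ω) ^ β * S ^ β / b ^ (r * β) := by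
    rw [hM, Real.rpow_mul hb0.le, show 2 * (S / b ^ r) / ω = 2 / ω * S / b ^ r by ring,
      Real.div_rpow (by positivity) (by positivity), Real.mul_rpow (by positivity) hS.le]
  rw [Real.rpow_add hh0, hhN, hhs, hMβ, hux, Real.mul_rpow two_pos.le hb0.le,
    Real.rpow_add hb0, Real.rpow_add (x := 2 / ω) (by positivity), Real.rpow_one]
  have h1 : (2 / ω) ^ β ≠ 0 := by positivity
  have h2 : S ^ β ≠ 0 := by positivity
  have h3 : b ^ (r * β) ≠ 0 := by positivity
  field_simp

/-- A fractional Gagliardo–Nirenberg inequality with exponent `p + s p r / N`. -/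
theorem lintegral_abs_rpow_le_gagliardo {N : ℕ} (hN : 1 ≤ N) {s p r S : ℝ} (hs : 0 < s)
    (hp : 0 < p) (hr : 0 < r) (hS : 0 < S) {u : E N → ℝ} (hu : AEMeasurable u volume)
    (huS : ∫⁻ y, ENNReal.ofReal (|u y| ^ r) ≤ ENNReal.ofReal S) :
    ∫⁻ x, ENNReal.ofReal (|u x| ^ (p + r * (s * p / N))) ≤
      ENNReal.ofReal (2 ^ (p + r * (s * p / N)) *
          (2 / volume.real (Metric.ball (0 : E N) 1)) ^ (1 + s * p / N) * S ^ (s * p / N)) *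
        gagliardo N s p u := by
  rw [gagliardo, ← lintegral_const_mul' _ _ ENNReal.ofReal_ne_top]
  exact lintegral_mono (ofReal_abs_rpow_le_lintegral hN hs hp hr hS hu huS)

theorem normConst_pos {N : ℕ} (hN : 1 ≤ N) {p s : ℝ} (hs0 : 0 < s) (hs1 : s < 1) (hp : 2 ≤ p) :
    0 < normConst N p s := by
  have hN0 : (0 : ℝ) < N := by exact_mod_cast hN
  have h1 : 0 < Real.Gamma ((p * s + p + (N : ℝ) - 2) / 2) :=
    Real.Gamma_pos_of_pos (by nlinarith)
  have h2 : 0 < Real.Gamma (1 - s) := Real.Gamma_pos_of_pos (by linarith)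
  unfold normConst
  positivity

theorem integrable_abs_rpow {α : Type*} [MeasurableSpace α] {μ : Measure α} {u : α → ℝ} {m : ℝ}
    (hm : 0 < m) (hu : MemLp u (ENNReal.ofReal m) μ) : Integrable (fun x => |u x| ^ m) μ := by
  simpa [ENNReal.toReal_ofReal hm.le] using
    hu.integrable_norm_rpow (by simpa using hm) ENNReal.ofReal_ne_top

theorem memLp_of_lintegral_abs_rpow_lt_top {α : Type*} [MeasurableSpace α] {μ : Measure α}
    {u : α → ℝ} {m : ℝ} (hm : 0 < m) (hu : AEStronglyMeasurable u μ)
    (h : ∫⁻ x, ENNReal.ofReal (|u x| ^ m) ∂μ < ∞) : MemLp u (ENNReal.ofReal m) μ := by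
  refine ⟨hu, ?_⟩
  rw [eLpNorm_lt_top_iff_lintegral_rpow_enorm_lt_top (by simpa using hm) ENNReal.ofReal_ne_top,
    ENNReal.toReal_ofReal hm.le]
  convert h using 2
  ext x
  rw [← Real.norm_eq_abs, ← ENNReal.ofReal_rpow_of_nonneg (norm_nonneg _) hm.le, ofReal_norm]

/-- Hölder's inequality between two powers on a finite measure space. -/
theorem integral_abs_rpow_le {α : Type*} [MeasurableSpace α] {μ : Measure α} [IsFiniteMeasure μ]
    {u : α → ℝ} {q m : ℝ} (hq : 0 < q) (hqm : q < m) (hu : MemLp u (ENNReal.ofReal m) μ) :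
    ∫ x, |u x| ^ q ∂μ ≤ μ.real univ ^ (1 - q / m) * (∫ x, |u x| ^ m ∂μ) ^ (q / m) := by
  have hm : 0 < m := hq.trans hqm
  have hconj : (m / q).HolderConjugate (1 - q / m)⁻¹ := by
    rw [Real.holderConjugate_iff]
    refine ⟨(one_lt_div hq).2 hqm, ?_⟩
    simp
  have hpow : ∀ x, (|u x| ^ q) ^ (m / q) = |u x| ^ m := fun x => by
    rw [← Real.rpow_mul (abs_nonneg _), mul_div_cancel₀ _ hq.ne']
  have hfm : MemLp (fun x => |u x| ^ q) (ENNReal.ofReal (m / q)) μ := by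
    refine memLp_of_lintegral_abs_rpow_lt_top (by positivity)
      (hu.1.aemeasurable.abs.pow_const q).aestronglyMeasurable ?_
    have := (integrable_abs_rpow hm hu).lintegral_lt_top
    convert this using 4 with x
    rw [abs_of_nonneg (by positivity), hpow]
  have := integral_mul_le_Lp_mul_Lq_of_nonneg hconj (μ := μ) (f := fun x => |u x| ^ q)
    (g := fun _ => 1) (.of_forall fun _ => by positivity) (.of_forall fun _ => zero_le_one) hfm
    (memLp_const 1)
  simp only [mul_one, hpow, Real.one_rpow, integral_const, smul_eq_mul, one_div, inv_inv,
    inv_div] at this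
  rwa [mul_comm] at this

theorem lintegral_abs_rpow_eq_setLIntegral {N : ℕ} {Ω : Set (E N)} (hΩ : MeasurableSet Ω)
    {u : E N → ℝ} (h : ∀ᵐ x : E N, x ∉ Ω → u x = 0) {r : ℝ} (hr : 0 < r) :
    ∫⁻ x, ENNReal.ofReal (|u x| ^ r) = ∫⁻ x in Ω, ENNReal.ofReal (|u x| ^ r) := by
  rw [← lintegral_indicator hΩ]
  refine lintegral_congr_ae ?_
  filter_upwards [h] with x hx
  by_cases hxΩ : x ∈ Ω
  · rw [indicator_of_mem hxΩ]
  · rw [indicator_of_notMem hxΩ, hx hxΩ, abs_zero, Real.zero_rpow hr.ne', ENNReal.ofReal_zero]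

end FracPLap

open FracPLap in
theorem lemma3p2 (N : ℕ) (hN : 1 ≤ N) (Ω : Set (FracPLap.E N)) (hΩ : IsOpen Ω)
    (hΩb : Bornology.IsBounded Ω) (s p q r : ℝ) (hs0 : 0 < s) (hs1 : s < 1)
    (hp : 2 ≤ p) (hq : 2 ≤ q) (hr : 2 ≤ r) (hpq : p < q)
    (hr' : (N : ℝ) * (q - p) / (s * p) < r) :
    ∃ ε : ℝ, 0 < ε ∧ ε ≤ 1 ∧
      ∃ F : ℝ → ℝ, Set.MapsTo F (Set.Ici 0) (Set.Ici 0) ∧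
        StrictMonoOn F (Set.Ici 0) ∧ DifferentiableOn ℝ F (Set.Ici 0) ∧
        ∀ u ∈ FracPLap.energySpace N s p r Ω,
          MeasureTheory.MemLp u (ENNReal.ofReal q) (MeasureTheory.volume.restrict Ω) ∧
          FracPLap.powEnergy N q Ω u ≤
            F (FracPLap.powEnergy N r Ω u) * (FracPLap.pEnergy N s p u + 1) ^ (1 - ε) := by
  have hN0 : (0 : ℝ) < N := by exact_mod_cast hN
  have hp0 : 0 < p := by linarith
  have hq0 : 0 < q := by linarith
  have hr0 : 0 < r := by linarith
  set β : ℝ := s * p / N with hβ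
  have hβ0 : 0 < β := by positivity
  set m : ℝ := p + r * β with hm
  -- This is the lower bound on `r`, rearranged.
  have hqm : q < m := by
    rw [div_lt_iff₀ (by positivity)] at hr'
    have : q - p < r * (s * p) / N := by rw [lt_div_iff₀ hN0]; linarith
    rw [hm, hβ, ← mul_div_assoc]; linarith
  have hm0 : 0 < m := hq0.trans hqm
  have hqm0 : 0 < q / m := by positivity
  have hqm1 : q / m < 1 := (div_lt_one hm0).2 hqm
  set ω : ℝ := volume.real (Metric.ball (0 : E N) 1) with hω
  have hω0 : 0 < ω := ENNReal.toReal_pos (Metric.measure_ball_pos _ _ one_pos).ne'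
    measure_ball_lt_top.ne
  set c : ℝ := 2 ^ m * (2 / ω) ^ (1 + β) with hc
  have hc0 : 0 < c := by positivity
  have hC0 : 0 < normConst N p s := normConst_pos hN hs0 hs1 hp
  set d : ℝ := 2 * p / normConst N p s with hd
  have hd0 : 0 < d := by positivity
  have : IsFiniteMeasure (volume.restrict Ω) := ⟨by
    rw [Measure.restrict_apply_univ]; exact hΩb.measure_lt_top⟩
  set w : ℝ := (volume.restrict Ω).real univ ^ (1 - q / m) with hw
  have hw0 : 0 ≤ w := by positivity
  -- `Ω` may be null, making `w` zero; `w + 1` keeps `K` positive and `F` strictly increasing.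
  set K : ℝ := (w + 1) * (c * d) ^ (q / m) with hK
  have hK0 : 0 < K := by positivity
  -- The `+ 1` keeps the base positive, so the power is differentiable even at `t = 0`.
  refine ⟨1 - q / m, by linarith, by linarith, fun t => K * (r * t + 1) ^ (β * (q / m)), ?_, ?_, ?_,
    fun u hu => ?_⟩
  · intro t ht
    have : (0 : ℝ) ≤ t := ht
    exact mem_Ici.2 (by positivity)
  · intro t ht t' _ htt
    have : (0 : ℝ) ≤ t := ht
    dsimp only
    gcongr
  · intro t ht
    have : (0 : ℝ) ≤ t := ht
    have h1 : DifferentiableAt ℝ (fun t : ℝ => r * t + 1) t := by fun_prop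
    exact ((h1.rpow_const (Or.inl (by positivity))).const_mul K).differentiableWithinAt
  obtain ⟨⟨⟨hup, hug⟩, hu0⟩, hur⟩ := hu
  set I : ℝ := ∫ x in Ω, |u x| ^ r with hI
  have hI0 : 0 ≤ I := integral_nonneg fun x => by positivity
  have hφ : r * powEnergy N r Ω u = I := by
    rw [powEnergy]; field_simp; exact hI.symm
  -- `I + 1` replaces `I` because the pointwise bound needs `S > 0`, while `u` may vanish a.e.
  have hS : ∫⁻ y, ENNReal.ofReal (|u y| ^ r) ≤ ENNReal.ofReal (I + 1) := by
    rw [lintegral_abs_rpow_eq_setLIntegral hΩ.measurableSet hu0 hr0,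
      ← ofReal_integral_eq_lintegral_ofReal (integrable_abs_rpow hr0 hur)
        (.of_forall fun x => by positivity)]
    exact ENNReal.ofReal_le_ofReal (by linarith)
  have hGN := lintegral_abs_rpow_le_gagliardo hN hs0 hp0 hr0 (S := I + 1) (by positivity)
    hup.1.aemeasurable hS
  rw [← hβ, ← hm, ← hω, ← hc] at hGN
  have hGN' : ∫⁻ x in Ω, ENNReal.ofReal (|u x| ^ m) ≤
      ENNReal.ofReal (c * (I + 1) ^ β * (gagliardo N s p u).toReal) := by
    rw [ENNReal.ofReal_mul (by positivity), ENNReal.ofReal_toReal hug.ne]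
    exact (setLIntegral_le_lintegral _ _).trans hGN
  have hum : MemLp u (ENNReal.ofReal m) (volume.restrict Ω) :=
    memLp_of_lintegral_abs_rpow_lt_top hm0 hup.1.restrict (hGN'.trans_lt ENNReal.ofReal_lt_top)
  refine ⟨hum.mono_exponent (ENNReal.ofReal_le_ofReal hqm.le), ?_⟩
  have hint : ∫ x in Ω, |u x| ^ m ≤ c * (I + 1) ^ β * (gagliardo N s p u).toReal := by
    rw [← ofReal_integral_eq_lintegral_ofReal (integrable_abs_rpow hm0 hum)
        (.of_forall fun x => by positivity)] at hGN'
    exact (ENNReal.ofReal_le_ofReal_iff (by positivity)).1 hGN'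
  set P : ℝ := pEnergy N s p u with hP
  have hPg : (gagliardo N s p u).toReal = d * P := by
    rw [hP, hd, pEnergy]; field_simp
  have hP0 : 0 ≤ P := by
    rw [hP, pEnergy]; positivity
  have hJ0 : 0 ≤ ∫ x in Ω, |u x| ^ q := integral_nonneg fun x => by positivity
  have hM0 : 0 ≤ ∫ x in Ω, |u x| ^ m := integral_nonneg fun x => by positivity
  have hbase : ∫ x in Ω, |u x| ^ m ≤ c * d * (I + 1) ^ β * (P + 1) := by
    refine hint.trans ?_
    rw [hPg, show c * (I + 1) ^ β * (d * P) = c * d * (I + 1) ^ β * P by ring]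
    gcongr
    linarith
  calc powEnergy N q Ω u ≤ ∫ x in Ω, |u x| ^ q := by
        rw [powEnergy]
        exact mul_le_of_le_one_left hJ0 ((div_le_one hq0).2 (by linarith))
    _ ≤ w * (∫ x in Ω, |u x| ^ m) ^ (q / m) := integral_abs_rpow_le hq0 hqm hum
    _ ≤ (w + 1) * (c * d * (I + 1) ^ β * (P + 1)) ^ (q / m) := by
        gcongr
        linarith
    _ = K * (r * powEnergy N r Ω u + 1) ^ (β * (q / m)) * (P + 1) ^ (1 - (1 - q / m)) := by
        rw [hφ, hK, sub_sub_cancel, Real.mul_rpow (by positivity) (by positivity),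
          Real.mul_rpow (by positivity) (by positivity), Real.rpow_mul (by positivity)]
        ring
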